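/- Let $\lambda$ be a singular cardinal, that is, an infinite cardinal with $\operatorname{cf}(\lambda) < \lambda$. Let $\mu = 2^{\lambda}$ and let $\kappa$ be the least cardinal such that $2^{\kappa} > \mu$. Then there is a Hausdorff topological space $X$ that has a basis consisting of clopen sets and has cardinality $|X| = 2^{\kappa}$, such that every closed subset $Y \subseteq X$ with $|Y| < |X|$ satisfies $|Y| < \lambda$. -/

import Mathlib

open Cardinal TopologicalSpace
universe u

/-!
The underlying set of the space consists of formal limits. A point is a tree which is either a
leaf or a node carrying a label `ξ` and a family `A` of `lam` many points, its children. There are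
`2 ^ kappa` labels and hence `2 ^ kappa` points. Every node `t` gets an ultrafilter `D t` on the
index set of its children, and the topology is generated by the sets `V` that *respect limits*: if
the children of `t` are pairwise distinct, then `t ∈ V` if and only if `D t`-almost all children of
`t` belong to `V`. These sets form a Boolean algebra, so the topology has a clopen basis. If a
closed set has at least `lam` points, then it contains the range of an injective family `A`, hence
all nodes with children `A`, one for each label, which makes `2 ^ kappa` points.

What remains is the Hausdorff property, and this is where the ultrafilters have to be chosen well:
for every family of at most `lam` nodes there should be *disjoint* sets `Y t`, such that almost all
children of `t` are in `Y t` (`CardinalLadder.exists_limitTree_ultrafilters`). Given two points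
`x ≠ y`, apply this to the set `H` of their subtrees, and shrink each `Y t` so that it misses `x`
and `y`. Let `V` contain the points of `H` reached from `x` by descending from `t` to
members of `Y t`. By disjointness `Y t` misses `V` when `t ∈ H` is not in `V`, so `V` respects
limits on `H`; outside `H` it is extended by recursion on trees (`LimitTree.t2Space`).

The disjoint sets `Y t` come from two independent sources.

* Distinct indices: there is a filter on the index set such that any `lam` many injective families
  `G j` have, after restriction to suitable sets `Z j` of the filter, no coincidence
  `G j i = G k i'` with `i ≠ i'` (`CardinalLadder.exists_separating`). Here singularity is used: the
  index set is a union of fewer than `lam` blocks of successor size `τ⁺ < lam`, only `τ` many of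
  the families matter on the block of size `τ⁺`, and on such a block the sets on which some
  regressive function has small fibres form a proper ideal. Ulam's matrix argument splits each block
  into many sets outside this ideal.
* Equal indices: each `D t` extends this filter, and for any `lam` many points `t` there are disjoint
  sets `E t ∈ D t` (`exists_separated_ultrafilters`). For this, one prescribes the values modulo
  `D t` of `2 ^ lam` many independent functions. As `kappa ≤ 2 ^ lam`, that many colourings of the
  points suffice for every family of `lam` points to be coloured injectively by one of them.
-/

/-! ### Sets carrying a regressive function with small fibres -/

theorem Cardinal.mk_iUnion_le_of_le {α ι : Type u} {τ : Cardinal.{u}} (hτ : ℵ₀ ≤ τ)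
    (hι : #ι ≤ τ) {f : ι → Set α} (hf : ∀ i, #(f i) ≤ τ) : #(⋃ i, f i) ≤ τ :=
  (mk_iUnion_le f).trans <| (mul_le_mul' hι (ciSup_le' hf)).trans (mul_eq_self hτ).le

/-- A subset `N` of an ordered set is regressively small with respect to a cardinal `τ` if some
function `g` has fibres of size at most `τ` on `N` and is regressive at all but `τ` many points of
`N`. On a well-order of type `τ⁺`, for infinite `τ`, every such set is nonstationary, by Fodor's lemma. -/
def RegressivelySmall {W : Type u} [LT W] (τ : Cardinal.{u}) (N : Set W) : Prop :=
  ∃ g : W → W, #{δ | δ ∈ N ∧ ¬ g δ < δ} ≤ τ ∧ ∀ α, #{δ | δ ∈ N ∧ g δ = α} ≤ τ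

namespace RegressivelySmall

variable {W : Type u} {τ : Cardinal.{u}}

theorem mono [LT W] {M N : Set W} (hN : RegressivelySmall τ N) (h : M ⊆ N) :
    RegressivelySmall τ M := by
  obtain ⟨g, h₁, h₂⟩ := hN
  exact ⟨g, (mk_le_mk_of_subset fun δ hδ => And.imp_left (@h δ) hδ).trans h₁,
    fun α => (mk_le_mk_of_subset fun δ hδ => And.imp_left (@h δ) hδ).trans (h₂ α)⟩

theorem of_card_le [LT W] {N : Set W} (hN : #N ≤ τ) : RegressivelySmall τ N :=
  ⟨id, (mk_le_mk_of_subset fun _ hδ => hδ.1).trans hN,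
    fun _ => (mk_le_mk_of_subset fun _ hδ => hδ.1).trans hN⟩

theorem iUnion [LT W] (hτ : ℵ₀ ≤ τ) {ι : Type u} (hι : #ι ≤ τ) {N : ι → Set W}
    (hN : ∀ i, RegressivelySmall τ (N i)) : RegressivelySmall τ (⋃ i, N i) := by
  classical
  choose g h₁ h₂ using hN
  refine ⟨fun δ => if h : ∃ i, δ ∈ N i then g h.choose δ else δ, ?_, fun α => ?_⟩
  · refine (mk_le_mk_of_subset ?_).trans (mk_iUnion_le_of_le hτ hι h₁)
    rintro δ ⟨hδ, hg⟩
    have h : ∃ i, δ ∈ N i := by simpa using hδ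
    simp only [dif_pos h] at hg
    exact Set.mem_iUnion.2 ⟨h.choose, h.choose_spec, hg⟩
  · refine (mk_le_mk_of_subset ?_).trans (mk_iUnion_le_of_le hτ hι fun i => h₂ i α)
    rintro δ ⟨hδ, hg⟩
    have h : ∃ i, δ ∈ N i := by simpa using hδ
    simp only [dif_pos h] at hg
    exact Set.mem_iUnion.2 ⟨h.choose, h.choose_spec, hg⟩

theorem union [LT W] (hτ : ℵ₀ ≤ τ) {M N : Set W} (hM : RegressivelySmall τ M)
    (hN : RegressivelySmall τ N) : RegressivelySmall τ (M ∪ N) := by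
  have h := iUnion hτ (ι := ULift.{u} Bool) ((lt_aleph0_of_finite _).le.trans hτ)
    (N := fun b => cond b.down M N) (by rintro ⟨_ | _⟩ <;> assumption)
  refine h.mono ?_
  rintro δ (h | h)
  · exact Set.mem_iUnion.2 ⟨⟨true⟩, h⟩
  · exact Set.mem_iUnion.2 ⟨⟨false⟩, h⟩

/-- Iterating `g` leads from every point to a point at which `g` is not regressive, and the points
for which this takes `n` steps are at most `τ` many. -/
theorem card_le_of_univ [LT W] [WellFoundedLT W] (hτ : ℵ₀ ≤ τ)
    (h : RegressivelySmall τ (Set.univ : Set W)) : #W ≤ τ := by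
  obtain ⟨g, h₁, h₂⟩ := h
  simp only [Set.mem_univ, true_and] at h₁ h₂
  have hn : ∀ n : ℕ, #{δ | ¬ g (g^[n] δ) < g^[n] δ} ≤ τ := by
    intro n
    induction n with
    | zero => simpa using h₁
    | succ n ih =>
      refine (mk_le_mk_of_subset ?_).trans (mk_iUnion_le_of_le hτ ih fun α => h₂ α.1)
      intro δ hδ
      exact Set.mem_iUnion.2 ⟨⟨g δ, hδ⟩, rfl⟩
  have hU : (⋃ n : ULift.{u} ℕ, {δ | ¬ g (g^[n.down] δ) < g^[n.down] δ}) = Set.univ := by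
    refine Set.eq_univ_of_forall fun δ => ?_
    by_contra hδ
    simp only [Set.mem_iUnion, Set.mem_ofPred_eq, not_exists, not_not] at hδ
    obtain ⟨m, hm⟩ := WellFounded.has_min (wellFounded_lt (α := W))
      (Set.range fun n : ℕ => g^[n] δ) ⟨δ, 0, rfl⟩
    obtain ⟨⟨n, rfl⟩, hm⟩ := hm
    refine hm (g^[n + 1] δ) ⟨n + 1, rfl⟩ ?_
    rw [Function.iterate_succ_apply']
    exact hδ ⟨n⟩
  rw [← mk_univ, ← hU]
  exact mk_iUnion_le_of_le hτ (by simpa using hτ) fun n => hn n.down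

/-- A well-order of type `τ⁺` can be coloured with any `τ` many colours such that no colour class is
regressively small, by Ulam's matrix argument. -/
theorem exists_coloring [LinearOrder W] [WellFoundedLT W] (hτ : ℵ₀ ≤ τ) (hW : τ < #W)
    (hIio : ∀ δ : W, #(Set.Iio δ) ≤ τ) {L : Type u} [Nonempty L] {S : Set L} (hS : #S ≤ τ) :
    ∃ e : W → L, ∀ s ∈ S, ¬ RegressivelySmall τ (e ⁻¹' {s}) := by
  classical
  have huniv : ¬ RegressivelySmall τ (Set.univ : Set W) := fun h =>
    (card_le_of_univ hτ h).not_gt hW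
  have hφ : ∀ δ : W, ∃ φ : Set.Iio δ → τ.out, Function.Injective φ := fun δ => by
    have := hIio δ
    rw [← mk_out τ] at this
    obtain ⟨φ⟩ := this
    exact ⟨φ, φ.injective⟩
  choose φ hφ using hφ
  -- the Ulam matrix: each row covers a final segment, each column consists of disjoint sets
  let U : W → τ.out → Set W := fun α n => {β | ∃ h : α < β, φ β ⟨α, h⟩ = n}
  have hU : ∀ α, ∃ n, ¬ RegressivelySmall τ (U α n) := by
    intro α
    by_contra! hα
    refine huniv (((iUnion hτ (mk_out τ).le hα).union hτ
      ((of_card_le (hIio α)).union hτ (of_card_le (N := {α}) ?_))).mono ?_)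
    · simpa using (one_lt_aleph0.le.trans hτ)
    · intro β _
      rcases lt_trichotomy α β with h | h | h
      · exact Or.inl (Set.mem_iUnion.2 ⟨φ β ⟨α, h⟩, h, rfl⟩)
      · exact Or.inr (Or.inr h.symm)
      · exact Or.inr (Or.inl h)
  choose n hn using hU
  have hfib : ∃ m, τ < #(n ⁻¹' {m}) := by
    by_contra! h
    have := mk_iUnion_le_of_le hτ (mk_out τ).le h
    rw [show (⋃ m, n ⁻¹' {m}) = Set.univ from by ext; simp, mk_univ] at this
    exact this.not_gt hW
  obtain ⟨m, hm⟩ := hfib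
  obtain ⟨j⟩ := hS.trans hm.le
  refine ⟨fun β => if h : ∃ s : S, β ∈ U (j s).1 m then h.choose.1 else Classical.arbitrary L,
    fun s hs hsmall => hn (j ⟨s, hs⟩).1 (hsmall.mono ?_)⟩
  have hjm : n (j ⟨s, hs⟩).1 = m := (j ⟨s, hs⟩).2
  rw [hjm]
  intro β hβ
  have h : ∃ s : S, β ∈ U (j s).1 m := ⟨⟨s, hs⟩, hβ⟩
  simp only [Set.mem_preimage, dif_pos h, Set.mem_singleton_iff]
  obtain ⟨h₁, h₂⟩ := h.choose_spec
  obtain ⟨h₃, h₄⟩ := hβ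
  have := congrArg Subtype.val (hφ β (h₂.trans h₄.symm))
  have := j.injective (Subtype.ext this)
  rw [this]

end RegressivelySmall

/-! ### The index set and its filter -/

/-- A set of fewer than `lam` infinite cardinals below `lam`, cofinal in `lam` and each at least as
large as the number of them. The set is presented as the range of an injective family, so that its
index type lives in the same universe as the cardinals. -/
structure CardinalLadder (lam : Cardinal.{u}) where
  /-- The index type of the family of cardinals. -/
  Stage : Type u
  /-- The family of cardinals. -/
  τ : Stage → Cardinal.{u}
  τ_injective : Function.Injective τ
  aleph0_le : ∀ z, ℵ₀ ≤ τ z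
  mk_stage_le : ∀ z, #Stage ≤ τ z
  τ_lt : ∀ z, τ z < lam
  exists_lt : ∀ c < lam, ∃ z, c < τ z

theorem Cardinal.IsSingular.nonempty_cardinalLadder {lam : Cardinal.{u}} (h : lam.IsSingular) :
    Nonempty (CardinalLadder lam) := by
  obtain ⟨s, hs, hcard⟩ := Order.exists_cof_eq lam.ord.ToType
  rw [Ordinal.cof_toType] at hcard
  have hω : ℵ₀ < lam := lt_of_le_of_ne h.aleph0_le (by rintro rfl; exact not_isSingular_aleph0 h)
  let b : Cardinal.{u} := max ℵ₀ lam.ord.cof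
  have hb : b < lam := max_lt hω h.cof_ord_lt
  -- passing to the set of cardinals makes the family injective
  let R : Set Cardinal.{u} :=
    Set.range fun x : {x : s // b ≤ #(Set.Iio x.1)} => #(Set.Iio x.1.1)
  let ρ : Shrink.{u} R ≃ R := (equivShrink R).symm
  have hR : #(Shrink.{u} R) ≤ lam.ord.cof := by
    have : #(Shrink.{u} R) ≤ #{x : s // b ≤ #(Set.Iio x.1)} := by
      refine mk_le_of_surjective (f := fun x => equivShrink R ⟨_, x, rfl⟩) ?_
      intro y
      obtain ⟨⟨c, x, rfl⟩, rfl⟩ := (equivShrink R).surjective y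
      exact ⟨x, rfl⟩
    exact this.trans ((mk_subtype_le _).trans hcard.le)
  have hbR : ∀ z, b ≤ (ρ z : Cardinal) := by
    intro z
    obtain ⟨x, hx⟩ := (ρ z).2
    rw [← hx]
    exact x.2
  refine ⟨⟨Shrink.{u} R, fun z => ρ z, Subtype.val_injective.comp ρ.injective,
    fun z => (le_max_left _ _).trans (hbR z),
    fun z => hR.trans ((le_max_right _ _).trans (hbR z)), fun z => ?_, fun c hc => ?_⟩⟩
  · obtain ⟨x, hx⟩ := (ρ z).2
    rw [← hx]
    simpa using mk_Iio_lt x.1.1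
  · have hc' : Order.succ (max c b) < lam := h.isSuccLimit.succ_lt (max_lt hc hb)
    have : (Order.succ (max c b)).ord < Ordinal.type (α := lam.ord.ToType) (· < ·) := by
      simpa using hc'
    obtain ⟨y, hys, hy⟩ := hs (Ordinal.enum (α := lam.ord.ToType) (· < ·) ⟨_, this⟩)
    have hle : Order.succ (max c b) ≤ #(Set.Iio y) := by
      have h₁ : #(Set.Iio (Ordinal.enum (α := lam.ord.ToType) (· < ·) ⟨_, this⟩))
          = Order.succ (max c b) := by
        have := Ordinal.card_typein (α := lam.ord.ToType) (r := (· < ·))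
          (Ordinal.enum (α := lam.ord.ToType) (· < ·) ⟨_, this⟩)
        rw [Ordinal.typein_enum, card_ord] at this
        exact this.symm
      rw [← h₁]
      exact mk_le_mk_of_subset (Set.Iio_subset_Iio hy)
    have hlt : max c b < #(Set.Iio y) := (Order.lt_succ _).trans_le hle
    refine ⟨ρ.symm ⟨_, ⟨⟨y, hys⟩, (le_max_right _ _).trans hlt.le⟩, rfl⟩, ?_⟩
    rw [Equiv.apply_symm_apply]
    exact (le_max_left _ _).trans_lt hlt

namespace CardinalLadder

variable {lam : Cardinal.{u}} (L : CardinalLadder lam)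

/-- The block at a stage `z` is the canonical well-order of type `(τ z)⁺`. -/
abbrev Block (z : L.Stage) : Type u := (Order.succ (L.τ z)).ord.ToType

/-- The disjoint union of all blocks, a set of size `lam`. It serves both as index set of the
children of a node and as a set of labels for `lam` many objects. -/
abbrev Index : Type u := Σ z, L.Block z

theorem mk_block (z : L.Stage) : #(L.Block z) = Order.succ (L.τ z) := mk_ord_toType _

theorem mk_Iio_block_le {z : L.Stage} (δ : L.Block z) : #(Set.Iio δ) ≤ L.τ z := by
  have : #(Set.Iio δ) < Order.succ (L.τ z) := by simpa using mk_Iio_lt δ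
  exact Order.lt_succ_iff.1 this

theorem mk_index (hlam : Order.IsSuccLimit lam) : #L.Index = lam := by
  apply le_antisymm
  · rw [mk_sigma]
    have hpos : lam ≠ 0 := hlam.ne_bot
    obtain ⟨z, -⟩ := L.exists_lt 0 (pos_iff_ne_zero.2 hpos)
    have hω : ℵ₀ ≤ lam := (L.aleph0_le z).trans (L.τ_lt z).le
    refine (sum_le_mk_mul_iSup _).trans ((mul_le_mul' ((L.mk_stage_le z).trans (L.τ_lt z).le)
      (ciSup_le' fun y => ?_)).trans (mul_eq_self hω).le)
    rw [mk_block]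
    exact (hlam.succ_lt (L.τ_lt y)).le
  · refine le_of_forall_lt fun c hc => ?_
    obtain ⟨z, hz⟩ := L.exists_lt c hc
    refine hz.trans_le ((Order.le_succ _).trans ?_)
    rw [← L.mk_block z]
    exact mk_le_of_injective (f := Sigma.mk z) sigma_mk_injective

theorem mk_active_le (z : L.Stage) : #{j : L.Index | L.τ j.1 < L.τ z} ≤ L.τ z := by
  have : {j : L.Index | L.τ j.1 < L.τ z} =
      ⋃ y : {y // L.τ y < L.τ z}, Set.range (Sigma.mk (β := L.Block) y.1) := by
    ext ⟨y, δ⟩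
    constructor
    · intro h
      exact Set.mem_iUnion.2 ⟨⟨y, h⟩, δ, rfl⟩
    · intro h
      obtain ⟨⟨y', h'⟩, δ', hδ⟩ := Set.mem_iUnion.1 h
      cases hδ
      exact h'
  rw [this]
  refine mk_iUnion_le_of_le (L.aleph0_le z) ((mk_subtype_le _).trans (L.mk_stage_le z)) fun y => ?_
  refine mk_range_le.trans ?_
  rw [mk_block]
  exact Order.succ_le_of_lt y.2

/-- The filter of the sets that contain all but a regressively small part of every sufficiently late
block. -/
def blockFilter (hlam : lam ≠ 0) : Filter L.Index where
  sets := {Z | ∃ y, ∀ z, L.τ y < L.τ z → RegressivelySmall (L.τ z) {δ | (⟨z, δ⟩ : L.Index) ∉ Z}}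
  univ_sets := by
    obtain ⟨y, -⟩ := L.exists_lt 0 (pos_iff_ne_zero.2 hlam)
    exact ⟨y, fun z _ => .of_card_le (by simp)⟩
  sets_of_superset := by
    rintro Y Z ⟨y, hy⟩ hYZ
    exact ⟨y, fun z hz => (hy z hz).mono fun δ hδ h => hδ (hYZ h)⟩
  inter_sets := by
    rintro Y Z ⟨y, hy⟩ ⟨y', hy'⟩
    have : ∃ x, L.τ y ≤ L.τ x ∧ L.τ y' ≤ L.τ x := by
      rcases le_total (L.τ y) (L.τ y') with h | h
      · exact ⟨y', h, le_rfl⟩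
      · exact ⟨y, le_rfl, h⟩
    obtain ⟨x, hx, hx'⟩ := this
    refine ⟨x, fun z hz => ((hy z (hx.trans_lt hz)).union (L.aleph0_le z)
      (hy' z (hx'.trans_lt hz))).mono fun δ hδ => ?_⟩
    by_contra h
    simp only [Set.mem_union, Set.mem_ofPred_eq, not_or, not_not] at h
    exact hδ h

variable {L}

theorem compl_singleton_mem_blockFilter {hlam : lam ≠ 0} (i : L.Index) :
    {i}ᶜ ∈ L.blockFilter hlam := by
  refine ⟨i.1, fun z hz => .of_card_le ?_⟩
  rw [mk_eq_zero_iff.2]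
  · exact zero_le
  · refine ⟨fun ⟨δ, hδ⟩ => ?_⟩
    simp only [Set.mem_ofPred_eq, Set.mem_compl_iff, Set.mem_singleton_iff, not_not] at hδ
    subst hδ
    exact lt_irrefl _ hz

variable (L) in
/-- There is a colouring of the index set by itself all of whose colour classes are positive with
respect to the block filter. -/
theorem exists_coloring (hlam : lam ≠ 0) : ∃ e : L.Index → L.Index,
    ∀ k, ∀ Z ∈ L.blockFilter hlam, ∃ i ∈ Z, e i = k := by
  have he : ∀ z, ∃ e : L.Block z → L.Index, ∀ k, L.τ k.1 < L.τ z →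
      ¬ RegressivelySmall (L.τ z) (e ⁻¹' {k}) := fun z => by
    have : Nonempty (L.Block z) := by
      rw [← mk_ne_zero_iff, mk_block]
      exact succ_ne_zero _
    have : Nonempty L.Index := ⟨⟨z, Classical.arbitrary _⟩⟩
    exact RegressivelySmall.exists_coloring (L.aleph0_le z)
      ((Order.lt_succ _).trans_eq (L.mk_block z).symm) L.mk_Iio_block_le (L.mk_active_le z)
  choose e he using he
  refine ⟨fun i => e i.1 i.2, fun k Z ⟨y, hy⟩ => ?_⟩
  obtain ⟨z, hz⟩ := L.exists_lt _ (max_lt (L.τ_lt y) (L.τ_lt k.1))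
  by_contra! h
  refine he z k ((le_max_right _ _).trans_lt hz) ((hy z ((le_max_left _ _).trans_lt hz)).mono ?_)
  exact fun δ hδ hδZ => h _ hδZ hδ

/-- Any `lam` many injective families indexed by `L.Index` can be restricted to sets in the block
filter such that afterwards coincidences occur only at equal indices. On the block at `z` only the
families whose label lies in an earlier block are kept; this leaves at most `τ z` many families, and
then the indices to be removed form a regressively small set. -/
theorem exists_separating (hlam : lam ≠ 0) {X : Type u} (G : L.Index → L.Index → X) :
    ∃ Z : L.Index → Set L.Index,
      (∀ j, Function.Injective (G j) → Z j ∈ L.blockFilter hlam) ∧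
      ∀ j k, ∀ i ∈ Z j, ∀ i' ∈ Z k, G j i = G k i' → i = i' := by
  let Z : L.Index → Set L.Index := fun j => {i | L.τ j.1 < L.τ i.1 ∧
    ∀ k : L.Index, L.τ k.1 < L.τ i.1 →
      (∀ i' : L.Index, L.τ i'.1 < L.τ i.1 → G j i ≠ G k i') ∧
      ∀ δ < i.2, G j i ≠ G k ⟨i.1, δ⟩}
  refine ⟨Z, fun j hj => ⟨j.1, fun z hz => ?_⟩, ?_⟩
  · have hτ := L.aleph0_le z
    let A := {k : L.Index | L.τ k.1 < L.τ z}
    have hA : #A ≤ L.τ z := L.mk_active_le z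
    -- indices colliding with an earlier block
    let B : Set (L.Block z) := ⋃ k : A, ⋃ i : A, {δ | G j ⟨z, δ⟩ = G k i}
    -- indices colliding with an earlier index of the same block
    let C : Set (L.Block z) := {δ | ∃ k : A, ∃ δ' < δ, G j ⟨z, δ⟩ = G k ⟨z, δ'⟩}
    have hsub : ∀ x : X, #{δ : L.Block z | G j ⟨z, δ⟩ = x} ≤ L.τ z := fun x => by
      refine (mk_le_one_iff_set_subsingleton.2 ?_).trans (one_lt_aleph0.le.trans hτ)
      intro δ hδ δ' hδ'
      exact sigma_mk_injective (hj (hδ.trans hδ'.symm))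
    have hB : RegressivelySmall (L.τ z) B :=
      .of_card_le (mk_iUnion_le_of_le hτ hA fun k => mk_iUnion_le_of_le hτ hA fun i => hsub _)
    have hC : RegressivelySmall (L.τ z) C := by
      classical
      refine ⟨fun δ => if h : δ ∈ C then h.choose_spec.choose else δ, ?_, fun α => ?_⟩
      · rw [mk_eq_zero_iff.2]
        · exact zero_le
        · refine ⟨fun ⟨δ, hδ, hg⟩ => hg ?_⟩
          simp only [dif_pos hδ]
          exact hδ.choose_spec.choose_spec.1
      · refine (mk_le_mk_of_subset ?_).trans
          (mk_iUnion_le_of_le hτ hA fun k => hsub (G k ⟨z, α⟩))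
        rintro δ ⟨hδ, hg⟩
        simp only [dif_pos hδ] at hg
        refine Set.mem_iUnion.2 ⟨hδ.choose, ?_⟩
        have := hδ.choose_spec.choose_spec.2
        rwa [hg] at this
    refine (hB.union hτ hC).mono fun δ hδ => ?_
    by_contra hBC
    refine hδ ⟨hz, fun k hk => ⟨fun i' hi' h => hBC (Or.inl ?_), fun δ' hδ' h => hBC (Or.inr ?_)⟩⟩
    · exact Set.mem_iUnion.2 ⟨⟨k, hk⟩, Set.mem_iUnion.2 ⟨⟨i', hi'⟩, h⟩⟩
    · exact ⟨⟨k, hk⟩, δ', hδ', h⟩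
  · rintro j k ⟨z, δ⟩ ⟨hj, hi⟩ ⟨z', δ'⟩ ⟨hk, hi'⟩ h
    rcases lt_trichotomy (L.τ z) (L.τ z') with hz | hz | hz
    · exact ((hi' j (hj.trans hz)).1 _ hz h.symm).elim
    · obtain rfl := L.τ_injective hz
      rcases lt_trichotomy δ δ' with hδ | rfl | hδ
      · exact ((hi' j hj).2 _ hδ h.symm).elim
      · rfl
      · exact ((hi k hk).2 _ hδ h).elim
    · exact ((hi k (hk.trans hz)).1 _ hz h).elim

end CardinalLadder

/-! ### Independent functions and separated ultrafilters -/

theorem Set.exists_finset_separating {K : Type u} (S : Finset (Set K)) :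
    ∃ s : Finset K, ∀ a ∈ S, ∀ b ∈ S, (∀ x ∈ s, x ∈ a ↔ x ∈ b) → a = b := by
  classical
  have h : ∀ p : Set K × Set K, ∃ s : Finset K, (∀ x ∈ s, x ∈ p.1 ↔ x ∈ p.2) → p.1 = p.2 := by
    intro p
    by_cases hp : p.1 = p.2
    · exact ⟨∅, fun _ => hp⟩
    · obtain ⟨x, hx⟩ : ∃ x, ¬ (x ∈ p.1 ↔ x ∈ p.2) := by
        by_contra! h
        exact hp (Set.ext h)
      exact ⟨{x}, fun h => (hx (h x (Finset.mem_singleton_self x))).elim⟩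
  choose s hs using h
  refine ⟨(S ×ˢ S).biUnion s, fun a ha b hb hab => hs (a, b) fun x hx => hab x ?_⟩
  exact Finset.mem_biUnion.2 ⟨(a, b), Finset.mk_mem_product ha hb, hx⟩

/-- There are `2 ^ #K` independent functions from an infinite set `K` to itself: any finitely many of
them take any prescribed values at a common point. Up to a bijection, the points are the pairs of a
finite set `s` and a function on the finite sets; the function with index `a` evaluates the latter
at `s ∩ a`. -/
theorem exists_independent_functions (K : Type u) [Infinite K] :
    ∃ f : Set K → K → K, ∀ (S : Finset (Set K)) (v : Set K → K), ∃ k, ∀ a ∈ S, f a k = v a := by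
  classical
  obtain ⟨k₀⟩ : Nonempty K := inferInstance
  let : Zero K := ⟨k₀⟩
  have hcard : #(Finset K × (Finset K →₀ K)) = #K := by
    simp [mk_finset_of_infinite, mul_eq_self (aleph0_le_mk K)]
  obtain ⟨E⟩ := Cardinal.eq.1 hcard
  refine ⟨fun a k => (E.symm k).2 ((E.symm k).1.filter (· ∈ a)), fun S v => ?_⟩
  obtain ⟨s, hs⟩ := Set.exists_finset_separating S
  -- `φ` maps the trace of `a ∈ S` on `s` to `v a`; distinct members of `S` have distinct traces
  let φ : Finset K →₀ K := Finsupp.onFinset (S.image fun a : Set K => s.filter (· ∈ a))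
    (fun t => if h : ∃ a ∈ S, s.filter (· ∈ a) = t then v h.choose else 0) (by
      intro t ht
      by_contra hn
      refine ht (dif_neg ?_)
      rintro ⟨a, ha, rfl⟩
      exact hn (Finset.mem_image_of_mem _ ha))
  refine ⟨E (s, φ), fun a ha => ?_⟩
  have h : ∃ b ∈ S, s.filter (· ∈ b) = s.filter (· ∈ a) := ⟨a, ha, rfl⟩
  have hba : h.choose = a := by
    refine hs _ h.choose_spec.1 _ ha fun x hx => ?_
    have := congrArg (x ∈ ·) h.choose_spec.2
    simpa [hx] using this
  simp only [Equiv.symm_apply_apply]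
  change (if h : ∃ b ∈ S, s.filter (· ∈ b) = s.filter (· ∈ a) then v h.choose else 0) = v a
  rw [dif_pos h, hba]

/-- There are `2 ^ #K` colourings of `X` by `K` such that each family of `#K` points of `X` is coloured
injectively by one of them. With `X` coded by subsets of `Kap`, a colouring is given by `#K` many
points of `Kap` and `#K` many traces on these points. -/
theorem exists_injective_colorings {K Kap X : Type u} [Infinite K] [Nonempty Kap]
    (hKap : #Kap ≤ 2 ^ #K)
    (hX : #X ≤ 2 ^ #Kap) :
    ∃ c : Set K → X → K, ∀ t : K → X, ∃ a, ∀ j k, c a (t j) = c a (t k) → t j = t k := by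
  classical
  have hK := aleph0_le_mk K
  have h2K : ((2 : Cardinal.{u}) ^ #K) ^ #K = 2 ^ #K := by
    rw [← power_mul, mul_eq_self hK]
  have hcode : #X ≤ #(Set Kap) := by rwa [mk_set]
  obtain ⟨code⟩ := hcode
  have hparam : #((K → Kap) × (K → Set K)) ≤ #(Set K) := by
    have h : #(K → Kap) ≤ 2 ^ #K := by
      rw [← power_def, ← h2K]
      exact power_le_power_right hKap
    have h' : #(K → Set K) ≤ 2 ^ #K := by
      rw [← power_def, mk_set, h2K]
    rw [mk_prod, lift_id, lift_id, mk_set]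
    exact (mul_le_mul' h h').trans (mul_eq_self (hK.trans (cantor _).le)).le
  obtain ⟨ι⟩ := hparam
  let dec : Set K → (K → Kap) × (K → Set K) := Function.invFun ι
  let trace : (K → Kap) → X → Set K := fun w x => {m | w m ∈ code x}
  refine ⟨fun a x => if h : ∃ k, (dec a).2 k = trace (dec a).1 x then h.choose
    else Classical.arbitrary K, fun t => ?_⟩
  obtain ⟨P⟩ : Nonempty (K ≃ K × K) := Cardinal.eq.1 (by simp [mul_eq_self hK])
  -- `w` picks for each pair of distinct points of the family a place where their codes differ
  have hw : ∀ m : K, ∃ p : Kap, t (P m).1 ≠ t (P m).2 →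
      ¬ (p ∈ code (t (P m).1) ↔ p ∈ code (t (P m).2)) := by
    intro m
    by_cases h : t (P m).1 = t (P m).2
    · exact ⟨Classical.arbitrary _, fun h' => (h' h).elim⟩
    · by_contra! hp
      exact h (code.injective (Set.ext fun p => (hp p).2))
  choose w hw using hw
  have hdec : dec (ι (w, fun k => trace w (t k))) = (w, fun k => trace w (t k)) :=
    Function.leftInverse_invFun ι.injective _
  refine ⟨ι (w, fun k => trace w (t k)), fun j k hjk => ?_⟩
  simp only [hdec] at hjk
  have hj : ∃ k', trace w (t k') = trace w (t j) := ⟨j, rfl⟩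
  have hk : ∃ k', trace w (t k') = trace w (t k) := ⟨k, rfl⟩
  rw [dif_pos hj, dif_pos hk] at hjk
  have htr : trace w (t j) = trace w (t k) := by
    rw [← hj.choose_spec, ← hk.choose_spec, hjk]
  by_contra hne'
  have h₁ := hw (P.symm (j, k))
  simp only [Equiv.apply_symm_apply] at h₁
  refine h₁ hne' ?_
  have := congrArg (P.symm (j, k) ∈ ·) htr
  simpa [trace] using this

/-- If each fibre of `e` is positive with respect to the filter `F`, then every `x : X` can be assigned
an ultrafilter finer than `F` so that any `#I` many of these ultrafilters are separated by disjoint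
sets. The ultrafilter at `x` decides that the `a`-th independent function, composed with `e`, has as
value the `a`-th colour of `x`. -/
theorem exists_separated_ultrafilters {I Kap X : Type u} [Infinite I] [Nonempty Kap]
    (hKap : #Kap ≤ 2 ^ #I) (hX : #X ≤ 2 ^ #Kap) (F : Filter I) {e : I → I}
    (he : ∀ k, ∀ Z ∈ F, ∃ i ∈ Z, e i = k) :
    ∃ D : X → Ultrafilter I, (∀ x, (D x : Filter I) ≤ F) ∧
      ∀ t : I → X, ∃ E : X → Set I, (∀ x, E x ∈ D x) ∧
        ∀ j k, ∀ i ∈ E (t j), i ∈ E (t k) → t j = t k := by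
  classical
  obtain ⟨f, hf⟩ := exists_independent_functions I
  obtain ⟨c, hc⟩ := exists_injective_colorings (X := X) hKap hX
  let B : X → Set I → Set I := fun x a => {k | f a k = c a x}
  have hB : ∀ x, (F ⊓ Filter.comap e (⨅ a, Filter.principal (B x a))).NeBot := by
    intro x
    rw [Filter.inf_neBot_iff]
    intro Z hZ U hU
    obtain ⟨V, hV, hVU⟩ := Filter.mem_comap.1 hU
    obtain ⟨S, hS⟩ := (Filter.mem_iInf_finite' _).1 hV
    obtain ⟨k, hk⟩ := hf (S.image PLift.down) (fun a => c a x)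
    have hkV : k ∈ V := by
      obtain ⟨s, hs⟩ := Filter.mem_iInf_finset.1 hS
      rw [hs.2]
      refine Set.mem_iInter₂.2 fun a ha => hs.1 a ha ?_
      exact hk a.down (Finset.mem_image_of_mem _ ha)
    obtain ⟨i, hiZ, hi⟩ := he k Z hZ
    exact ⟨i, hiZ, hVU (by rw [Set.mem_preimage, hi]; exact hkV)⟩
  choose D hD using fun x => @Ultrafilter.exists_le _ _ (hB x)
  refine ⟨D, fun x => (hD x).trans inf_le_left, fun t => ?_⟩
  obtain ⟨a, ha⟩ := hc t
  refine ⟨fun x => e ⁻¹' B x a, fun x => ?_, fun j k i hj hk => ha j k (hj.symm.trans hk)⟩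
  refine (hD x).trans inf_le_right ?_
  exact Filter.preimage_mem_comap (Filter.mem_iInf_of_mem a (Filter.mem_principal_self _))

/-! ### The space of limit trees -/

/-- Well-founded trees whose nodes carry a label in `Ξ` and have children indexed by `I`. -/
inductive LimitTree (I Ξ : Type u) : Type u
  | leaf : LimitTree I Ξ
  | node (ξ : Ξ) (A : I → LimitTree I Ξ) : LimitTree I Ξ

namespace LimitTree

variable {I Ξ : Type u}

/-- The family of children of a tree. A leaf is its own child, so that its family of children is not
injective and imposes no condition on the topology. -/
def children : LimitTree I Ξ → I → LimitTree I Ξ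
  | leaf => fun _ => leaf
  | node _ A => A

/-- The trees as a W-type, with a nullary constructor at `none` and constructors of arity `I` at
`some ξ`. -/
def toWType : LimitTree I Ξ → WType (fun o : Option Ξ => {_i : I // o ≠ none})
  | leaf => ⟨none, fun i => (i.2 rfl).elim⟩
  | node ξ A => ⟨some ξ, fun i => (A i).toWType⟩

theorem toWType_injective : Function.Injective (toWType (I := I) (Ξ := Ξ)) := by
  intro s
  induction s with
  | leaf =>
    rintro (_ | ⟨ξ, A⟩) h
    · rfl
    · simp [toWType] at h
  | node ξ A ih =>
    rintro (_ | ⟨ξ', A'⟩) h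
    · simp [toWType] at h
    · simp only [toWType, WType.mk.injEq, Option.some.injEq] at h
      obtain ⟨rfl, h⟩ := h
      have h' := eq_of_heq h
      congr 1
      funext i
      exact ih i (congrFun h' ⟨i, by simp⟩)

theorem mk_eq [Infinite I] (hΞ : #Ξ ^ #I = #Ξ) (h1 : 1 < #Ξ) : #(LimitTree I Ξ) = #Ξ := by
  have hI := aleph0_le_mk I
  have hω : ℵ₀ ≤ #Ξ := by
    rw [← hΞ]
    exact hI.trans ((cantor _).le.trans (power_le_power_right (two_le_iff_one_lt.2 h1)))
  apply le_antisymm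
  · refine (mk_le_of_injective toWType_injective).trans (WType.cardinalMk_le_of_le ?_)
    refine (sum_le_mk_mul_iSup _).trans ?_
    refine (mul_le_mul' (?_ : _ ≤ #Ξ) (ciSup_le' fun o => ?_ : _ ≤ #Ξ)).trans (mul_eq_self hω).le
    · rw [mk_option]
      exact (add_one_eq hω).le
    · exact (power_le_power_left (by rintro h; simp [h] at h1) (mk_subtype_le _)).trans hΞ.le
  · exact mk_le_of_injective (f := fun ξ => node ξ fun _ => leaf) fun ξ ξ' h => by
      injection h

/-- The set of all subtrees of a tree, including the tree itself. -/
def subtrees : LimitTree I Ξ → Set (LimitTree I Ξ)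
  | leaf => {leaf}
  | node ξ A => insert (node ξ A) (⋃ i, (A i).subtrees)

theorem self_mem_subtrees (t : LimitTree I Ξ) : t ∈ t.subtrees := by
  cases t <;> simp [subtrees]

theorem children_mem_subtrees {s t : LimitTree I Ξ} (h : s ∈ t.subtrees) (i : I) :
    s.children i ∈ t.subtrees := by
  induction t with
  | leaf =>
    obtain rfl : s = leaf := h
    rfl
  | node ξ A ih =>
    rcases h with rfl | h
    · exact Or.inr (Set.mem_iUnion.2 ⟨i, (A i).self_mem_subtrees⟩)
    · obtain ⟨k, hk⟩ := Set.mem_iUnion.1 h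
      exact Or.inr (Set.mem_iUnion.2 ⟨k, ih k hk⟩)

theorem mk_subtrees_le [Infinite I] (t : LimitTree I Ξ) : #t.subtrees ≤ #I := by
  have hI := aleph0_le_mk I
  induction t with
  | leaf => simpa [subtrees] using one_lt_aleph0.le.trans hI
  | node ξ A ih =>
    refine mk_insert_le.trans ?_
    exact (add_le_add (mk_iUnion_le_of_le hI le_rfl ih) (one_lt_aleph0.le.trans hI)).trans
      (add_eq_self hI).le

variable (D : LimitTree I Ξ → Ultrafilter I)

/-- A set respects limits if it contains a tree with pairwise distinct children exactly when it
contains almost all of the children. -/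
def RespectsLimits (V : Set (LimitTree I Ξ)) : Prop :=
  ∀ t, Function.Injective t.children → (t ∈ V ↔ ∀ᶠ i in D t, t.children i ∈ V)

/-- The topology generated by the sets that respect limits. -/
abbrev limitTopology : TopologicalSpace (LimitTree I Ξ) :=
  generateFrom {V | RespectsLimits D V}

variable {D}

theorem RespectsLimits.compl {V : Set (LimitTree I Ξ)} (hV : RespectsLimits D V) :
    RespectsLimits D Vᶜ := fun t ht => by
  rw [Set.mem_compl_iff, hV t ht, ← Ultrafilter.eventually_not]
  rfl

theorem RespectsLimits.inter {V V' : Set (LimitTree I Ξ)} (hV : RespectsLimits D V)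
    (hV' : RespectsLimits D V') : RespectsLimits D (V ∩ V') := fun t ht => by
  rw [Set.mem_inter_iff, hV t ht, hV' t ht, ← Filter.eventually_and]
  rfl

theorem respectsLimits_univ : RespectsLimits D Set.univ := fun t _ => by simp

theorem isTopologicalBasis_respectsLimits :
    @IsTopologicalBasis _ (limitTopology D) {V | RespectsLimits D V} :=
  let := limitTopology D
  { exists_subset_inter := fun _ h₁ _ h₂ _ hx => ⟨_, h₁.inter h₂, hx, subset_rfl⟩
    sUnion_eq := Set.eq_univ_of_forall fun _ =>
      Set.mem_sUnion.2 ⟨_, respectsLimits_univ, Set.mem_univ _⟩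
    eq_generateFrom := rfl }

theorem RespectsLimits.isClopen {V : Set (LimitTree I Ξ)} (hV : RespectsLimits D V) :
    @IsClopen _ (limitTopology D) V :=
  let := limitTopology D
  ⟨⟨isTopologicalBasis_respectsLimits.isOpen hV.compl⟩,
    isTopologicalBasis_respectsLimits.isOpen hV⟩

theorem isTopologicalBasis_isClopen :
    @IsTopologicalBasis _ (limitTopology D) {V | @IsClopen _ (limitTopology D) V} :=
  let := limitTopology D
  isTopologicalBasis_respectsLimits.of_isOpen_of_subset (fun _ hV => hV.isOpen)
    fun _ hV => RespectsLimits.isClopen hV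

/-- A closed set contains every tree whose children are distinct and belong to the set. -/
theorem mem_of_isClosed {Y : Set (LimitTree I Ξ)} (hY : @IsClosed _ (limitTopology D) Y)
    {t : LimitTree I Ξ} (ht : Function.Injective t.children) (h : ∀ i, t.children i ∈ Y) :
    t ∈ Y := by
  let := limitTopology D
  rw [← hY.closure_eq, isTopologicalBasis_respectsLimits.mem_closure_iff]
  intro V hV htV
  obtain ⟨i, hi⟩ := ((hV t ht).1 htV).exists
  exact ⟨_, hi, h i⟩

theorem mk_le_of_isClosed {Y : Set (LimitTree I Ξ)} (hY : @IsClosed _ (limitTopology D) Y)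
    (h : #I ≤ #Y) : #Ξ ≤ #Y := by
  obtain ⟨a⟩ := h
  refine mk_le_of_injective (f := fun ξ => (⟨node ξ fun i => a i, ?_⟩ : Y)) ?_
  · exact mem_of_isClosed hY (Subtype.val_injective.comp a.injective) fun i => (a i).2
  · intro ξ ξ' h
    have := congrArg Subtype.val h
    injection this

/-- The set which agrees with `V` on `H` and at leaves, and which contains any other tree exactly when
it contains almost all of its children. -/
def limitExtension (D : LimitTree I Ξ → Ultrafilter I) (H V : Set (LimitTree I Ξ)) :
    LimitTree I Ξ → Prop
  | leaf => leaf ∈ V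
  | node ξ A => (node ξ A ∈ H ∧ node ξ A ∈ V) ∨
      (node ξ A ∉ H ∧ ∀ᶠ i in D (node ξ A), (A i).limitExtension D H V)

theorem limitExtension_iff_of_mem {H V : Set (LimitTree I Ξ)} {t : LimitTree I Ξ} (ht : t ∈ H) :
    t.limitExtension D H V ↔ t ∈ V := by
  cases t <;> simp [limitExtension, ht]

/-- The topology is Hausdorff if the ultrafilters are nonprincipal and the children of any `#I` many
trees can be separated by disjoint sets, up to negligible sets of children. -/
theorem t2Space [Infinite I] (hD : ∀ t, (D t : Filter I) ≤ Filter.cofinite)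
    (hsep : ∀ H : Set (LimitTree I Ξ), #H ≤ #I → ∃ Y : LimitTree I Ξ → Set (LimitTree I Ξ),
      (∀ t ∈ H, Function.Injective t.children → ∀ᶠ i in D t, t.children i ∈ Y t) ∧
      (∀ t ∈ H, Y t ⊆ Set.range t.children) ∧
      ∀ s ∈ H, ∀ t ∈ H, ∀ z ∈ Y s, z ∈ Y t → s = t) :
    @T2Space _ (limitTopology D) := by
  let := limitTopology D
  refine ⟨fun x y hxy => ?_⟩
  have hI := aleph0_le_mk I
  let H := x.subtrees ∪ y.subtrees
  have hxH : x ∈ H := Or.inl x.self_mem_subtrees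
  have hyH : y ∈ H := Or.inr y.self_mem_subtrees
  have hH : ∀ t ∈ H, ∀ i, t.children i ∈ H := fun t ht i =>
    ht.imp (fun h => children_mem_subtrees h i) fun h => children_mem_subtrees h i
  obtain ⟨Y, hY, hYH, hYd⟩ := hsep H <| (mk_union_le _ _).trans <|
    (add_le_add x.mk_subtrees_le y.mk_subtrees_le).trans (add_eq_self hI).le
  let R : LimitTree I Ξ → LimitTree I Ξ → Prop := fun t z => z ∈ Y t ∧ z ≠ x ∧ z ≠ y
  have hR : ∀ t ∈ H, Function.Injective t.children → ∀ᶠ i in D t, R t (t.children i) := by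
    intro t ht hinj
    have hne : ∀ z, ∀ᶠ i in D t, t.children i ≠ z := fun z =>
      hD t ((Set.subsingleton_singleton.preimage hinj).finite.compl_mem_cofinite)
    exact (hY t ht hinj).and ((hne x).and (hne y))
  let V₀ : Set (LimitTree I Ξ) := {z | Relation.ReflTransGen R x z}
  have hV₀H : V₀ ⊆ H := by
    intro z hz
    induction hz with
    | refl => exact hxH
    | tail _ hR ih =>
      obtain ⟨i, rfl⟩ := hYH _ ih hR.1
      exact hH _ ih i
  let V : Set (LimitTree I Ξ) := {z | z.limitExtension D H V₀}
  have hVH : ∀ t ∈ H, (t ∈ V ↔ t ∈ V₀) := fun t ht => limitExtension_iff_of_mem ht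
  have hV : RespectsLimits D V := by
    intro t ht
    by_cases htH : t ∈ H
    · have hV' : ∀ i, (t.children i ∈ V ↔ t.children i ∈ V₀) := fun i => hVH _ (hH t htH i)
      simp only [hVH t htH, hV']
      constructor
      · intro htV
        exact (hR t htH ht).mono fun i hi => Relation.ReflTransGen.tail htV hi
      · intro h
        obtain ⟨i, hi, hRi⟩ := (h.and (hR t htH ht)).exists
        rcases Relation.ReflTransGen.cases_tail hi with h | ⟨s, hs, hsR⟩
        · exact (hRi.2.1 h).elim
        · -- the child lies in `Y t` and in `Y s` with `s ∈ V₀`, whence `s = t`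
          rwa [hYd t htH s (hV₀H hs) _ hRi.1 hsR.1]
    · cases t with
      | leaf =>
        obtain ⟨i, j, hij⟩ := exists_pair_ne I
        exact (hij (ht rfl)).elim
      | node ξ A =>
        change (_ ∧ _ ∨ _ ∧ _) ↔ _
        simp only [htH, false_and, false_or, not_false_eq_true, true_and]
        rfl
  have hx : x ∈ V := (hVH x hxH).2 Relation.ReflTransGen.refl
  have hy : y ∉ V := by
    rw [hVH y hyH]
    intro h
    rcases Relation.ReflTransGen.cases_tail h with h | ⟨s, -, hsR⟩
    · exact hxy h.symm
    · exact hsR.2.2 rfl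
  exact ⟨V, Vᶜ, hV.isClopen.isOpen, hV.isClopen.compl.isOpen, hx, hy, disjoint_compl_right⟩

end LimitTree

/-- The ultrafilters can be chosen such that the children of any `lam` many trees can be separated. The
separating set of `t` contains the children with index in `Z ∩ E`, where `Z` excludes coincidences
between different indices and `E` excludes coincidences at equal indices. -/
theorem CardinalLadder.exists_limitTree_ultrafilters {lam : Cardinal.{u}} (L : CardinalLadder lam)
    (hlam : lam ≠ 0) [Infinite L.Index] {Kap Ξ : Type u} [Nonempty Kap]
    (hKap : #Kap ≤ 2 ^ #L.Index) (hcard : #(LimitTree L.Index Ξ) ≤ 2 ^ #Kap) :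
    ∃ D : LimitTree L.Index Ξ → Ultrafilter L.Index,
      (∀ t, (D t : Filter L.Index) ≤ Filter.cofinite) ∧
      ∀ H : Set (LimitTree L.Index Ξ), #H ≤ #L.Index →
        ∃ Y : LimitTree L.Index Ξ → Set (LimitTree L.Index Ξ),
          (∀ t ∈ H, Function.Injective t.children → ∀ᶠ i in D t, t.children i ∈ Y t) ∧
          (∀ t ∈ H, Y t ⊆ Set.range t.children) ∧
          ∀ s ∈ H, ∀ t ∈ H, ∀ z ∈ Y s, z ∈ Y t → s = t := by
  classical
  obtain ⟨e, he⟩ := L.exists_coloring hlam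
  obtain ⟨D, hDF, hD⟩ := exists_separated_ultrafilters hKap hcard _ he
  refine ⟨D, fun t => (hDF t).trans ?_, fun H hH => ?_⟩
  · rw [Filter.le_cofinite_iff_compl_singleton_mem]
    exact compl_singleton_mem_blockFilter
  rcases H.eq_empty_or_nonempty with rfl | hne
  · exact ⟨fun _ => ∅, by simp, by simp, by simp⟩
  have : Nonempty H := hne.to_subtype
  obtain ⟨φ⟩ := hH
  let u : L.Index → LimitTree L.Index Ξ := fun j => (Function.invFun φ j : H)
  have hu : ∀ t (ht : t ∈ H), u (φ ⟨t, ht⟩) = t := fun t ht =>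
    congrArg Subtype.val (Function.leftInverse_invFun φ.injective ⟨t, ht⟩)
  obtain ⟨Z, hZ, hZd⟩ := exists_separating hlam fun j => (u j).children
  obtain ⟨E, hE, hEd⟩ := hD u
  refine ⟨fun t => {z | ∃ ht : t ∈ H, ∃ i, i ∈ Z (φ ⟨t, ht⟩) ∧ i ∈ E t ∧ t.children i = z},
    fun t ht hinj => ?_, ?_, ?_⟩
  · have h₁ := hDF t (hZ (φ ⟨t, ht⟩) (by rwa [hu t ht]))
    filter_upwards [h₁, hE t] with i hi hi'
    exact ⟨ht, i, hi, hi', rfl⟩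
  · rintro t - z ⟨-, i, -, -, rfl⟩
    exact ⟨i, rfl⟩
  · rintro s hs t ht z ⟨_, i, hi, hiE, rfl⟩ ⟨_, k, hk, hkE, hki⟩
    have hik : i = k := hZd _ _ i hi k hk (by rw [hu, hu, hki])
    subst hik
    have := hEd (φ ⟨s, hs⟩) (φ ⟨t, ht⟩) i (by rwa [hu]) (by rwa [hu])
    rwa [hu, hu] at this

theorem theorem2p1 (lam mu kappa : Cardinal.{u})
    (hinf : ℵ₀ ≤ lam) (hsing : lam.ord.cof < lam)
    (hmu : mu = 2 ^ lam)
    (hkappa : IsLeast {c : Cardinal.{u} | mu < 2 ^ c} kappa) :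
    ∃ (X : Type u) (_ : TopologicalSpace X),
      T2Space X ∧
      IsTopologicalBasis {U : Set X | IsClopen U} ∧
      #X = 2 ^ kappa ∧
      ∀ Y : Set X, IsClosed Y → #Y < #X → #Y < lam := by
  subst hmu
  have hs : lam.IsSingular := ⟨hinf, hsing.ne⟩
  obtain ⟨L⟩ := hs.nonempty_cardinalLadder
  have hlam : lam ≠ 0 := hs.pos.ne'
  have hI : #L.Index = lam := L.mk_index hs.isSuccLimit
  have : Infinite L.Index := infinite_iff.2 (hinf.trans_eq hI.symm)
  have hκμ : kappa ≤ 2 ^ lam := hkappa.2 (cantor _)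
  have hκ : lam ≤ kappa := by
    by_contra! h
    exact (power_le_power_left two_ne_zero h.le).not_gt hkappa.1
  have hκω : ℵ₀ ≤ kappa := hinf.trans hκ
  have hKap : #kappa.out = kappa := mk_out _
  have : Nonempty kappa.out := by
    rw [← mk_ne_zero_iff, hKap]
    exact (aleph0_pos.trans_le hκω).ne'
  have hΞ : #(Set kappa.out) = 2 ^ kappa := by rw [mk_set, hKap]
  have hX : #(LimitTree L.Index (Set kappa.out)) = 2 ^ kappa := by
    rw [LimitTree.mk_eq ?_ ?_, hΞ]
    · rw [hΞ, hI, ← power_mul, mul_eq_left hκω hκ hlam]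
    · rw [hΞ]
      exact (one_lt_aleph0.trans_le hκω).trans (cantor _)
  obtain ⟨D, hD, hsep⟩ := L.exists_limitTree_ultrafilters hlam (Kap := kappa.out)
    (Ξ := Set kappa.out) (by rwa [hKap, hI]) (by rw [hX, hKap])
  refine ⟨LimitTree L.Index (Set kappa.out), LimitTree.limitTopology D,
    LimitTree.t2Space hD hsep, LimitTree.isTopologicalBasis_isClopen, hX, fun Y hY hlt => ?_⟩
  by_contra! h
  refine hlt.not_ge ?_
  rw [hX, ← hΞ]
  exact LimitTree.mk_le_of_isClosed hY (hI.trans_le h)
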